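/- **Colored two-ball prime juggling patterns.** A *colored two-ball state* is a sequence $\alpha=\langle\alpha_1,\alpha_2,\dots\rangle$ with entries in $\{0,\text{orange},\text{blue}\}$ in which each of the two colors occurs exactly once ($\alpha_i\neq 0$ means that the ball of that color lands $i$ beats from now). There is a transition $\alpha\to\beta$ if $\beta_i=\alpha_{i+1}$ for every $i\ge 1$ with $\alpha_{i+1}\ne 0$ (so a ball that lands now, $\alpha_1\neq 0$, is thrown to an arbitrary free position). A *colored two-ball prime juggling pattern* of length $n$ is a closed walk of length $n$ through $n$ pairwise distinct colored states, where two walks are the same pattern if they differ only by the choice of the starting beat and by exchanging the two colors. Let $C'(2,n)$ be the number of these patterns. For integers $t,n\ge 1$ let $c_t(n)$ be the number of sequences $(S_1,\dots,S_t)$, up to cyclic rotation, of pairwise disjoint nonempty finite sets of positive integers with $\sum_{i=1}^t\max S_i=n$; it is $0$ if $t>n$. **Theorem.** For every $n\ge1$ the number $C'(2,n)$ is finite. If $n$ is odd, then $$C'(2,n)=\sum_{m=1}^{(n-1)/2}\ \sum_{t\ge1} t\,c_t(m)\,c_t(n-m).$$ If $n$ is even, then $$C'(2,n)=\sum_{m=1}^{n/2-1}\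 \sum_{t\ge1} t\,c_t(m)\,c_t(n-m)+\sum_{t\ge1}\left(t\binom{c_t(n/2)}{2}+\left\lceil\frac t2\right\rceil c_t(n/2)\right).$$ -/

import Mathlib

/-- A state of two-ball colored juggling: `entry i` is the entry `α_{i+1}` of the state vector
`⟨α₁, α₂, …⟩`, i.e. it is `some c` if the ball of color `c` lands `i + 1` beats from the present and
`none` (the entry `0`) if no ball does.  There are two balls, one of each of the two colors. -/
@[ext]
structure ColoredState where
  entry : ℕ → Option (Fin 2)
  existsUnique_entry : ∀ c : Fin 2, ∃! i : ℕ, entry i = some c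

namespace ColoredState

/-- The one-beat transition `α → β`, i.e. `α_{i+1} ≤ β_i` for all `i`, colors included: every ball
that does not land now comes one beat closer.  As `β` is again a state, a ball that lands now is
thrown to an arbitrary free position. -/
def Step (α β : ColoredState) : Prop :=
  ∀ (i : ℕ) (c : Fin 2), α.entry (i + 1) = some c → β.entry i = some c

/-- Rename the two colors by the permutation `π`. -/
def recolor (π : Equiv.Perm (Fin 2)) (α : ColoredState) : ColoredState where
  entry i := (α.entry i).map π
  existsUnique_entry c := by
    have h : ∀ i, (α.entry i).map π = some c ↔ α.entry i = some (π.symm c) := by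
      intro i
      cases α.entry i <;> simp [Equiv.eq_symm_apply]
    simpa only [h] using α.existsUnique_entry (π.symm c)

theorem recolor_one (α : ColoredState) : recolor 1 α = α := by
  ext1
  funext i
  cases h : α.entry i <;> simp [recolor, h]

theorem recolor_recolor (π ρ : Equiv.Perm (Fin 2)) (α : ColoredState) :
    recolor π (recolor ρ α) = recolor (π * ρ) α := by
  ext1
  funext i
  cases h : α.entry i <;> simp [recolor, h]

end ColoredState

/-- A prime closed walk of length `n ≥ 1` in the graph of colored two-ball states: it visits `n`
distinct colored states before it returns to its start. -/
structure ColoredPrimeWalk (n : ℕ) where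
  state : ZMod n → ColoredState
  step : ∀ i, (state i).Step (state (i + 1))
  injective : Function.Injective state

/-- Two prime closed walks are the same pattern if they differ by the choice of the starting beat
and by the names of the two colors. -/
def ColoredPrimeWalk.setoid (n : ℕ) : Setoid (ColoredPrimeWalk n) where
  r v w := ∃ (k : ZMod n) (π : Equiv.Perm (Fin 2)),
    ∀ i, w.state i = (v.state (i + k)).recolor π
  iseqv :=
    { refl := fun v => ⟨0, 1, fun i => by rw [add_zero, ColoredState.recolor_one]⟩
      symm := by
        rintro v w ⟨k, π, h⟩
        refine ⟨-k, π⁻¹, fun i => ?_⟩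
        rw [h, ColoredState.recolor_recolor, neg_add_cancel_right, inv_mul_cancel,
          ColoredState.recolor_one]
      trans := by
        rintro u v w ⟨k, π, h⟩ ⟨l, ρ, h'⟩
        refine ⟨l + k, ρ * π, fun i => ?_⟩
        rw [h', h, ColoredState.recolor_recolor, add_assoc] }

/-- The set `𝒞'(2, n)` of colored two-ball prime juggling patterns of length `n`. -/
def ColoredPrimePattern (n : ℕ) : Type :=
  Quotient (ColoredPrimeWalk.setoid n)

/-- A sequence `S₁, …, S_t` of nonempty finite sets of positive integers that are pairwise disjoint
and whose maxima add up to `n`. -/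
structure SpacingSeq (t n : ℕ) where
  sets : Fin t → Finset ℕ
  nonempty : ∀ i, (sets i).Nonempty
  pos : ∀ i, ∀ x ∈ sets i, 1 ≤ x
  disjoint : ∀ i j, i ≠ j → Disjoint (sets i) (sets j)
  sum_max : ∑ i, (sets i).sup id = n

/-- Equality of sequences of sets up to cyclic order. -/
def SpacingSeq.setoid (t n : ℕ) : Setoid (SpacingSeq t n) where
  r S T := ∃ k : ℤ, ∀ i, T.sets i = S.sets ((finRotate t ^ k) i)
  iseqv :=
    { refl := fun S => ⟨0, fun i => by simp⟩
      symm := by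
        rintro S T ⟨k, h⟩
        exact ⟨-k, fun i => by rw [h, ← Equiv.Perm.mul_apply, ← zpow_add]; simp⟩
      trans := by
        rintro S T U ⟨k, h⟩ ⟨l, h'⟩
        exact ⟨k + l, fun i => by rw [h', h, ← Equiv.Perm.mul_apply, ← zpow_add]⟩ }

/-- The set `𝒳_{t,n}` of sequences `(S₁, …, S_t)` as above, up to cyclic order. -/
def SpacingCycle (t n : ℕ) : Type :=
  Quotient (SpacingSeq.setoid t n)

instance (t n : ℕ) : Finite (SpacingSeq t n) := by
  have hmem : ∀ (S : SpacingSeq t n) (i : Fin t), S.sets i ∈ (Finset.range (n + 1)).powerset := by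
    intro S i
    rw [Finset.mem_powerset]
    intro x hx
    have h1 : x ≤ (S.sets i).sup id := Finset.le_sup (f := id) hx
    have h2 : (S.sets i).sup id ≤ ∑ j, (S.sets j).sup id :=
      Finset.single_le_sum (f := fun j => (S.sets j).sup id) (fun _ _ => Nat.zero_le _)
        (Finset.mem_univ i)
    rw [S.sum_max] at h2
    exact Finset.mem_range.2 (by omega)
  refine Finite.of_injective
    (fun S : SpacingSeq t n => fun i => (⟨S.sets i, hmem S i⟩ : (Finset.range (n + 1)).powerset)) ?_
  rintro ⟨S, _, _, _, _⟩ ⟨T, _, _, _, _⟩ h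
  have : S = T := by
    funext i
    exact congrArg Subtype.val (congrFun h i)
  subst this
  rfl

instance (t n : ℕ) : Finite (SpacingCycle t n) := Quotient.finite _

/-- `c_t(n) = |𝒳_{t,n}|`. -/
noncomputable def spacingCount (t n : ℕ) : ℕ :=
  Nat.card (SpacingCycle t n)

/-- `c_t(n) = 0` for `t > n`, so that every sum over `t` below is finite. -/
theorem spacingCount_eq_zero_of_lt {t n : ℕ} (h : n < t) : spacingCount t n = 0 := by
  have : IsEmpty (SpacingSeq t n) := by
    refine ⟨fun S => ?_⟩
    have h1 : ∑ _i : Fin t, 1 ≤ ∑ i, (S.sets i).sup id := by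
      refine Finset.sum_le_sum fun i _ => ?_
      obtain ⟨x, hx⟩ := S.nonempty i
      exact (S.pos i x hx).trans (Finset.le_sup (f := id) hx)
    rw [S.sum_max] at h1
    simp at h1
    omega
  have : IsEmpty (SpacingCycle t n) := ⟨fun q => Quotient.inductionOn q fun S => this.false S⟩
  exact Nat.card_of_isEmpty

/-! A walk is determined by its landing word, which records the color of the ball landing at each
beat: the states are recovered as the waits until the next landing of each color. Cut the word into
runs, a new run starting whenever the landing color changes, and attach to each run the set of
distances from its landings to the start of the next run. The maximum of this set is the length of
the run, and each distance is the wait for the other ball. A state in which a ball lands is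
determined by that ball's color and this wait, so primality says exactly that runs of the same color
within one period have disjoint sets.

Colors alternate, so a period has an even number `2 * t` of runs, and changing the starting beat or
the colors only rotates the cyclic list of sets. Thus patterns are the orbits of `ZMod (2 * t)` on
`RunSeq t n`, summed over `t` (`ColoredPrimePattern.bijective_pattern`).

The orbits are counted with Burnside's lemma. Separating the two colors gives `t ^ 2 * ∑ c_t(m)
c_t(n - m)` run sequences (`bijective_interleave`, `SpacingSeq.natCard`). A nonzero rotation with a
fixed point must be rotation by `t` with `t` odd; its fixed points run twice through one sequence of
total `n / 2`, which gives `t * c_t(n / 2)` of them. Dividing by `2 * t` and folding the sum along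
`m ↔ n - m` yields the formulas; the extra fixed points produce the ceiling. -/

/-! ### Walks are determined by their landing words -/

/-- In the landing word `h`, the first landing of the color `a` at or after time `i` is at time
`i + k`. -/
def FirstHit (h : ℕ → Option (Fin 2)) (i : ℕ) (a : Fin 2) (k : ℕ) : Prop :=
  h (i + k) = some a ∧ ∀ l < k, h (i + l) ≠ some a

namespace FirstHit

variable {h : ℕ → Option (Fin 2)} {i k l : ℕ} {a b : Fin 2}

theorem unique (hk : FirstHit h i a k) (hl : FirstHit h i a l) : k = l := by
  rcases lt_trichotomy k l with hlt | heq | hgt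
  · exact absurd hk.1 (hl.2 k hlt)
  · exact heq
  · exact absurd hl.1 (hk.2 l hgt)

theorem color_unique (ha : FirstHit h i a k) (hb : FirstHit h i b k) : a = b :=
  Option.some_injective _ (ha.1.symm.trans hb.1)

theorem exists_of_hit (hk : h (i + k) = some a) : ∃ l, FirstHit h i a l := by
  classical
  have hex : ∃ l, h (i + l) = some a := ⟨k, hk⟩
  exact ⟨Nat.find hex, Nat.find_spec hex, fun l hl => Nat.find_min hex hl⟩

theorem add (hk : FirstHit h i a (l + k)) : FirstHit h (i + l) a k := by
  refine ⟨by rw [add_assoc]; exact hk.1, fun m hm => ?_⟩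
  rw [add_assoc]
  exact hk.2 _ (by omega)

theorem map_iff {h' : ℕ → Option (Fin 2)} {s : ℕ} {π : Equiv.Perm (Fin 2)}
    (hh : ∀ i, h' i = (h (i + s)).map π) :
    FirstHit h' i (π a) k ↔ FirstHit h (i + s) a k := by
  have key : ∀ l, h' (i + l) = some (π a) ↔ h (i + s + l) = some a := by
    intro l
    rw [hh, add_right_comm]
    cases h (i + s + l) <;> simp
  simp only [FirstHit, key, ne_eq]

end FirstHit

theorem ColoredState.ext_some {α β : ColoredState}
    (h : ∀ k a, α.entry k = some a ↔ β.entry k = some a) : α = β := by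
  ext1
  funext k
  exact Option.ext (h k)

/-- The color of the ball that lands at time `i`, if any. -/
def ColoredPrimeWalk.hit {n : ℕ} (w : ColoredPrimeWalk n) (i : ℕ) : Option (Fin 2) :=
  (w.state i).entry 0

namespace ColoredPrimeWalk

variable {n : ℕ} (w v : ColoredPrimeWalk n)

theorem hit_add_self (i : ℕ) : w.hit (i + n) = w.hit i := by
  simp [hit]

theorem entry_of_entry_add {i l k : ℕ} {a : Fin 2} (h : (w.state i).entry (l + k) = some a) :
    (w.state (i + l : ℕ)).entry k = some a := by
  induction l generalizing i with
  | zero => simpa using h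
  | succ l ih =>
    have h1 := w.step i (l + k) a (by rw [← h]; congr 1; omega)
    have h2 := ih (i := i + 1) (by simpa using h1)
    rwa [show i + 1 + l = i + (l + 1) by omega] at h2

theorem firstHit_of_entry {i k : ℕ} {a : Fin 2} (h : (w.state i).entry k = some a) :
    FirstHit w.hit i a k := by
  refine ⟨w.entry_of_entry_add (by simpa using h), fun l hl hh => ?_⟩
  obtain ⟨m, rfl⟩ := Nat.exists_eq_add_of_lt hl
  have h1 : (w.state (i + l : ℕ)).entry (m + 1) = some a :=
    w.entry_of_entry_add (by rwa [← add_assoc])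
  have h2 := ((w.state (i + l : ℕ)).existsUnique_entry a).unique h1 hh
  omega

/-- A ball due in `k` beats cannot land sooner, because its color occupies only one entry of each
state. Hence the landing word determines the whole walk. -/
theorem entry_iff {i k : ℕ} {a : Fin 2} :
    (w.state i).entry k = some a ↔ FirstHit w.hit i a k := by
  refine ⟨w.firstHit_of_entry, fun h => ?_⟩
  obtain ⟨l, hl, -⟩ := (w.state i).existsUnique_entry a
  rwa [h.unique (w.firstHit_of_entry hl)]

theorem exists_firstHit (i : ℕ) (a : Fin 2) : ∃ k, FirstHit w.hit i a k := by
  obtain ⟨l, hl, -⟩ := (w.state i).existsUnique_entry a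
  exact ⟨l, w.firstHit_of_entry hl⟩

-- Since states are functions of the landing word, equality of patterns can be tested on words
-- alone.
variable {w v} in
theorem rel_iff [NeZero n] : (setoid n).r v w ↔
    ∃ (k : ℕ) (π : Equiv.Perm (Fin 2)), ∀ i, w.hit i = (v.hit (i + k)).map π := by
  constructor
  · rintro ⟨k, π, h⟩
    refine ⟨k.val, π, fun i => ?_⟩
    simp [hit, h, ColoredState.recolor]
  · rintro ⟨k, π, h⟩
    refine ⟨k, π, fun i => ColoredState.ext_some fun l a => ?_⟩
    obtain ⟨i, rfl⟩ := ZMod.natCast_zmod_surjective i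
    have hr : ((v.state (i + k)).recolor π).entry l = some a ↔
        (v.state ((i + k : ℕ) : ZMod n)).entry l = some (π.symm a) := by
      rw [Nat.cast_add]
      simp only [ColoredState.recolor]
      cases (v.state (i + k)).entry l <;> simp [Equiv.eq_symm_apply]
    rw [hr, entry_iff, entry_iff, ← FirstHit.map_iff h, Equiv.apply_symm_apply]

end ColoredPrimeWalk

/-! ### Words that come from prime walks -/

/-- The landing words of prime walks of length `n`. -/
structure IsPrimeWord (n : ℕ) (h : ℕ → Option (Fin 2)) : Prop where
  periodic : ∀ i, h (i + n) = h i
  exists_hit : ∀ i a, ∃ k, h (i + k) = some a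
  prime : ∀ i j a b k, a ≠ b → h i = some a → h j = some a → FirstHit h i b k →
    FirstHit h j b k → i ≡ j [MOD n]

namespace IsPrimeWord

variable {n : ℕ} {h : ℕ → Option (Fin 2)} (hh : IsPrimeWord n h)

open Classical in
/-- The state at time `i` of a walk with the given landing word. -/
noncomputable def state (i : ℕ) : ColoredState where
  entry k := if FirstHit h i 0 k then some 0 else if FirstHit h i 1 k then some 1 else none
  existsUnique_entry c := by
    obtain ⟨k, hk⟩ := hh.exists_hit i c
    obtain ⟨l, hl⟩ := FirstHit.exists_of_hit hk
    have key : ∀ k, (if FirstHit h i 0 k then some 0 else if FirstHit h i 1 k then some 1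
        else none) = some c ↔ FirstHit h i c k := by
      intro k
      have h01 : FirstHit h i 0 k → ¬ FirstHit h i 1 k :=
        fun h0 h1 => absurd (h0.color_unique h1) (by decide)
      fin_cases c <;> by_cases h0 : FirstHit h i 0 k <;> by_cases h1 : FirstHit h i 1 k <;>
        simp_all
    simp only [key]
    exact ⟨l, hl, fun y hy => hy.unique hl⟩

theorem state_entry {i k : ℕ} {c : Fin 2} :
    (hh.state i).entry k = some c ↔ FirstHit h i c k := by
  have h01 : FirstHit h i 0 k → ¬ FirstHit h i 1 k :=
    fun h0 h1 => absurd (h0.color_unique h1) (by decide)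
  simp only [state]
  fin_cases c <;> by_cases h0 : FirstHit h i 0 k <;> by_cases h1 : FirstHit h i 1 k <;>
    simp_all

theorem apply_mod (hh : IsPrimeWord n h) (i : ℕ) : h (i % n) = h i :=
  Function.Periodic.map_mod_nat (f := h) hh.periodic i

theorem state_mod (i : ℕ) : hh.state (i % n) = hh.state i := by
  refine ColoredState.ext_some fun k a => ?_
  rw [state_entry, state_entry]
  have key : ∀ l, h (i % n + l) = h (i + l) := by
    intro l
    rw [← hh.apply_mod, Nat.mod_add_mod, hh.apply_mod]
  simp only [FirstHit, key]

/-- Two equal states stay equal until their first ball lands, `k` beats later. At that beat the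
landing color and the wait for the other color agree, so comparing landing times is enough for
primality. -/
theorem modEq_of_state_eq {i j : ℕ} (hij : hh.state i = hh.state j) : i ≡ j [MOD n] := by
  have key : ∀ a k, FirstHit h i a k ↔ FirstHit h j a k := by
    intro a k
    rw [← hh.state_entry, ← hh.state_entry, hij]
  have aux : ∀ a b k l, a ≠ b → k ≤ l → FirstHit h i a k → FirstHit h i b l →
      i ≡ j [MOD n] := by
    intro a b k l hab hkl ha hb
    obtain ⟨m, rfl⟩ := Nat.exists_eq_add_of_le hkl
    exact Nat.ModEq.add_right_cancel' k (hh.prime (i + k) (j + k) a b m hab ha.1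
      ((key a k).1 ha).1 hb.add ((key b _).1 hb).add)
  obtain ⟨k, hk⟩ := hh.exists_hit i 0
  obtain ⟨k, hk⟩ := FirstHit.exists_of_hit hk
  obtain ⟨l, hl⟩ := hh.exists_hit i 1
  obtain ⟨l, hl⟩ := FirstHit.exists_of_hit hl
  rcases le_total k l with hkl | hkl
  · exact aux 0 1 k l (by decide) hkl hk hl
  · exact aux 1 0 l k (by decide) hkl hl hk

/-- The prime walk with the given landing word. -/
noncomputable def walk [NeZero n] : ColoredPrimeWalk n where
  state i := hh.state i.val
  step i k c hc := by
    obtain ⟨i, rfl⟩ := ZMod.natCast_zmod_surjective i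
    rw [ZMod.val_natCast, state_mod, state_entry, add_comm k 1] at hc
    rw [← Nat.cast_succ, ZMod.val_natCast, state_mod, state_entry]
    exact hc.add
  injective i j hij := by
    have := (ZMod.natCast_eq_natCast_iff _ _ n).2 (hh.modEq_of_state_eq hij)
    simpa using this

theorem hit_walk [NeZero n] : hh.walk.hit = h := by
  funext i
  refine Option.ext fun a => ?_
  simp only [ColoredPrimeWalk.hit, walk, ZMod.val_natCast, state_mod]
  rw [state_entry]
  simp [FirstHit]

end IsPrimeWord

/-- The landing ball and the wait for the other one already determine the state, so injectivity of
the walk applies. -/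
theorem ColoredPrimeWalk.eq_of_firstHit {n : ℕ} (w : ColoredPrimeWalk n) {i j k : ℕ}
    {a b : Fin 2} (hab : a ≠ b) (hi : w.hit i = some a) (hj : w.hit j = some a)
    (hik : FirstHit w.hit i b k) (hjk : FirstHit w.hit j b k) : i ≡ j [MOD n] := by
  rw [← ZMod.natCast_eq_natCast_iff]
  apply w.injective
  refine ColoredState.ext_some fun l c => ?_
  have ha : ∀ i, w.hit i = some a → FirstHit w.hit i a 0 := fun i hi =>
    ⟨by simpa using hi, by simp⟩
  have hc : c = a ∨ c = b := by omega
  rw [w.entry_iff, w.entry_iff]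
  rcases hc with rfl | rfl
  · exact ⟨fun h => h.unique (ha i hi) ▸ ha j hj, fun h => h.unique (ha j hj) ▸ ha i hi⟩
  · exact ⟨fun h => h.unique hik ▸ hjk, fun h => h.unique hjk ▸ hik⟩

/-! ### Run decompositions -/

/-- A decomposition of the landing word `h` from time `r 0` on into runs: run `j` occupies the times
from `r j` to `r (j + 1) - 1`, only balls of color `a j` land during it, namely at the times
`r (j + 1) - x` with `x ∈ V j`, and the colors of successive runs differ. -/
structure Runs (h : ℕ → Option (Fin 2)) (V : ℕ → Finset ℕ) (r : ℕ → ℕ) (a : ℕ → Fin 2) :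
    Prop where
  nonempty : ∀ j, (V j).Nonempty
  pos : ∀ j, ∀ x ∈ V j, 1 ≤ x
  start_succ : ∀ j, r (j + 1) = r j + (V j).sup id
  hit : ∀ j x u, 1 ≤ x → x ≤ (V j).sup id → u + x = r (j + 1) →
    h u = if x ∈ V j then some (a j) else none
  color_succ : ∀ j, a (j + 1) ≠ a j

theorem Finset.sup_id_mem {s : Finset ℕ} (hs : s.Nonempty) : s.sup id ∈ s := by
  obtain ⟨x, hx, h⟩ := s.exists_mem_eq_sup hs id
  rw [h]
  exact hx

namespace Runs

variable {h h' : ℕ → Option (Fin 2)} {V V' : ℕ → Finset ℕ} {r r' : ℕ → ℕ} {a a' : ℕ → Fin 2}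

theorem le_sup (_ : Runs h V r a) {j x : ℕ} (hx : x ∈ V j) : x ≤ (V j).sup id :=
  Finset.le_sup (f := id) hx

theorem sup_mem (H : Runs h V r a) (j : ℕ) : (V j).sup id ∈ V j :=
  Finset.sup_id_mem (H.nonempty j)

theorem one_le_sup (H : Runs h V r a) (j : ℕ) : 1 ≤ (V j).sup id :=
  H.pos j _ (H.sup_mem j)

theorem strictMono (H : Runs h V r a) : StrictMono r := by
  refine strictMono_nat_of_lt_succ fun j => ?_
  have := H.one_le_sup j
  rw [H.start_succ]
  omega

theorem hit_of_mem (H : Runs h V r a) {j x u : ℕ} (hx : x ∈ V j) (hu : u + x = r (j + 1)) :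
    h u = some (a j) := by
  rw [H.hit j x u (H.pos j x hx) (H.le_sup hx) hu, if_pos hx]

theorem hit_start (H : Runs h V r a) (j : ℕ) : h (r j) = some (a j) :=
  H.hit_of_mem (H.sup_mem j) (H.start_succ j).symm

theorem mem_of_hit (H : Runs h V r a) {j x u : ℕ} {b : Fin 2} (hx : 1 ≤ x)
    (hx' : x ≤ (V j).sup id) (hu : u + x = r (j + 1)) (hb : h u = some b) :
    x ∈ V j ∧ a j = b := by
  rw [H.hit j x u hx hx' hu] at hb
  split_ifs at hb with hmem
  exact ⟨hmem, Option.some_injective _ hb⟩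

/-- The next run opens with a landing of its own color, and the current run has none of that color.
This identifies the elements of `V j` with waits and so links primality to disjointness. -/
theorem firstHit (H : Runs h V r a) {j x u : ℕ} (hx : x ∈ V j) (hu : u + x = r (j + 1)) :
    FirstHit h u (a (j + 1)) x := by
  refine ⟨by rw [hu, H.hit_start], fun l hl hh => ?_⟩
  have hle := H.le_sup hx
  exact H.color_succ j (H.mem_of_hit (x := x - l) (by omega) (by omega) (by omega) hh).2.symm

theorem exists_block (H : Runs h V r a) {u : ℕ} (hu : r 0 ≤ u) :
    ∃ j x, 1 ≤ x ∧ x ≤ (V j).sup id ∧ u + x = r (j + 1) := by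
  induction u, hu using Nat.le_induction with
  | base => exact ⟨0, _, H.one_le_sup 0, le_rfl, (H.start_succ 0).symm⟩
  | succ u _ ih =>
    obtain ⟨j, x, hx, hx', hu⟩ := ih
    rcases hx.eq_or_lt with rfl | hlt
    · exact ⟨j + 1, _, H.one_le_sup _, le_rfl, by rw [hu, ← H.start_succ]⟩
    · exact ⟨j, x - 1, by omega, by omega, by omega⟩

/-- This description ignores colors, so it can be compared across recolorings. -/
theorem mem_iff (H : Runs h V r a) {j x : ℕ} :
    x ∈ V j ↔ 1 ≤ x ∧ x ≤ (V j).sup id ∧ ∀ u, u + x = r (j + 1) → h u ≠ none := by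
  constructor
  · intro hx
    refine ⟨H.pos j x hx, H.le_sup hx, fun u hu => ?_⟩
    simp [H.hit_of_mem hx hu]
  · rintro ⟨hx, hx', hu⟩
    have hs := H.start_succ j
    by_contra hmem
    refine hu (r (j + 1) - x) (by omega) ?_
    rw [H.hit j x _ hx hx' (by omega), if_neg hmem]

/-- The run decomposition of a translate of a landing word is determined by its start. -/
theorem unique (H : Runs h V r a) (H' : Runs h' V' r' a') {s m : ℕ} {π : Equiv.Perm (Fin 2)}
    (hh : ∀ i, h' i = (h (i + s)).map π) (h0 : r m = r' 0 + s) (i : ℕ) :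
    r (m + i) = r' i + s ∧ V (m + i) = V' i := by
  have key : ∀ i, r (m + i) = r' i + s → (V (m + i)).sup id = (V' i).sup id := by
    intro i hi
    have hc : ∀ i, r (m + i) = r' i + s → π (a (m + i)) = a' i := by
      intro i hi
      have h1 := hh (r' i)
      rw [H'.hit_start, ← hi, H.hit_start] at h1
      exact (Option.some_injective _ h1).symm
    have h1 := hc i hi
    have h2 : π (a (m + i + 1)) = a' (i + 1) := by
      have h3 := H.color_succ (m + i)
      have h4 := H'.color_succ i
      have h5 : π (a (m + i + 1)) ≠ π (a (m + i)) := fun h => h3 (π.injective h)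
      omega
    have h3 := H.firstHit (H.sup_mem (m + i)) (H.start_succ (m + i)).symm
    have h4 := H'.firstHit (H'.sup_mem i) (H'.start_succ i).symm
    rw [hi] at h3
    rw [← h2, FirstHit.map_iff hh] at h4
    exact h3.unique h4
  have hr : ∀ i, r (m + i) = r' i + s := by
    intro i
    induction i with
    | zero => exact h0
    | succ i ih =>
      rw [← add_assoc, H.start_succ, H'.start_succ, key i ih, ih]
      omega
  refine ⟨hr i, Finset.ext fun x => ?_⟩
  rw [H.mem_iff, H'.mem_iff, key i (hr i)]
  refine and_congr_right fun _ => and_congr_right fun _ => ?_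
  have h1 := hr (i + 1)
  rw [← add_assoc] at h1
  have h2 : (V' i).sup id + r' i = r' (i + 1) := by rw [H'.start_succ, add_comm]
  constructor
  · intro hu u hx
    rw [hh, Option.map_eq_none_iff.ne]
    exact hu _ (by omega)
  · intro hu u hx
    have h3 := hr i
    have h4 := key i h3
    have h5 := H.start_succ (m + i)
    have h6 := hu (u - s)
    rw [hh, Option.map_eq_none_iff.ne] at h6
    have h7 : u - s + s = u := by omega
    rw [h7] at h6
    exact h6 (by omega)

theorem map_hit (H : Runs h V r a) (H' : Runs h' V' r' a') {s : ℕ} {π : Equiv.Perm (Fin 2)}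
    (h0 : r' 0 = 0) (hr : ∀ j, r j = r' j + s) (hV : ∀ j, V j = V' j)
    (ha : ∀ j, π (a j) = a' j) (i : ℕ) : h' i = (h (i + s)).map π := by
  obtain ⟨j, x, hx, hx', hu⟩ := H'.exists_block (u := i) (by omega)
  rw [H'.hit j x i hx hx' hu, H.hit j x (i + s) hx (by rwa [hV]) (by rw [hr]; omega), hV]
  split_ifs <;> simp [ha]

end Runs

/-! ### Words built from cyclic run sequences -/

/-- The color of the `j`-th run if the runs start with color `0`. -/
def alternatingColor (j : ℕ) : Fin 2 := Fin.ofNat 2 j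

theorem alternatingColor_succ_ne (j : ℕ) : alternatingColor (j + 1) ≠ alternatingColor j := by
  simp only [alternatingColor, ne_eq, Fin.ext_iff, Fin.val_ofNat]
  omega

theorem alternatingColor_eq_iff {i j : ℕ} :
    alternatingColor i = alternatingColor j ↔ i % 2 = j % 2 := by
  simp [alternatingColor, Fin.ext_iff]

/-- The sets of distances that belong to the runs of a prime pattern with `2 * t` runs, in cyclic
order. Runs of the same color have disjoint sets. -/
@[ext]
structure RunSeq (t n : ℕ) [NeZero t] where
  sets : ZMod (2 * t) → Finset ℕ
  nonempty : ∀ i, (sets i).Nonempty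
  pos : ∀ i, ∀ x ∈ sets i, 1 ≤ x
  disjoint : ∀ i j, 2 * i ≠ 0 → Disjoint (sets j) (sets (j + 2 * i))
  sum_max : ∑ i, (sets i).sup id = n

theorem ZMod.sum_range_natCast {N : ℕ} [NeZero N] (f : ZMod N → ℕ) :
    ∑ i ∈ Finset.range N, f i = ∑ i, f i := by
  refine Finset.sum_nbij (fun i => (i : ZMod N)) (by simp) ?_ ?_ (by simp)
  · intro i hi j hj hij
    simp only [Finset.coe_range, Set.mem_Iio] at hi hj
    have := (ZMod.natCast_eq_natCast_iff' _ _ _).1 hij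
    rwa [Nat.mod_eq_of_lt hi, Nat.mod_eq_of_lt hj] at this
  · intro i _
    exact ⟨i.val, by simpa using ZMod.val_lt i, by simp⟩

namespace RunSeq

variable {t n : ℕ} [NeZero t]

instance : AddAction (ZMod (2 * t)) (RunSeq t n) where
  vadd k U :=
    { sets := fun j => U.sets (j + k)
      nonempty := fun j => U.nonempty _
      pos := fun j => U.pos _
      disjoint := fun i j hi => by
        rw [add_right_comm]
        exact U.disjoint i _ hi
      sum_max := (Equiv.sum_comp (Equiv.addRight k) fun j => (U.sets j).sup id).trans U.sum_max }
  zero_vadd U := RunSeq.ext (funext fun j => congrArg U.sets (add_zero j))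
  add_vadd k l U := RunSeq.ext (funext fun j => congrArg U.sets (add_assoc j k l).symm)

theorem vadd_sets (k : ZMod (2 * t)) (U : RunSeq t n) (j : ZMod (2 * t)) :
    (k +ᵥ U).sets j = U.sets (j + k) := rfl

variable (U : RunSeq t n)

/-- The time at which the `j`-th run starts. -/
def start (j : ℕ) : ℕ := ∑ i ∈ Finset.range j, (U.sets i).sup id

theorem start_zero : U.start 0 = 0 := rfl

theorem start_succ (j : ℕ) : U.start (j + 1) = U.start j + (U.sets j).sup id :=
  Finset.sum_range_succ _ _

theorem one_le_sup (j : ZMod (2 * t)) : 1 ≤ (U.sets j).sup id :=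
  U.pos j _ (Finset.sup_id_mem (U.nonempty j))

theorem start_strictMono : StrictMono U.start := by
  refine strictMono_nat_of_lt_succ fun j => ?_
  have := U.one_le_sup j
  rw [U.start_succ]
  omega

theorem start_two_mul : U.start (2 * t) = n := by
  rw [start, ZMod.sum_range_natCast (fun i => (U.sets i).sup id), U.sum_max]

theorem start_add (j q : ℕ) : U.start (j + 2 * t * q) = U.start j + n * q := by
  have hq : U.start (2 * t * q) = n * q ∧
      ∀ j, U.start (j + 2 * t * q) = U.start j + U.start (2 * t * q) := by
    have hj : ∀ q j, U.start (j + 2 * t * q) = U.start j + U.start (2 * t * q) := by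
      intro q j
      induction j with
      | zero => simp [start_zero]
      | succ j ih =>
        have hc : ((j + 2 * t * q : ℕ) : ZMod (2 * t)) = j := by
          rw [Nat.cast_add, Nat.cast_mul (2 * t) q, ZMod.natCast_self, zero_mul, add_zero]
        rw [add_right_comm, start_succ, ih, start_succ, hc, add_right_comm]
    refine ⟨?_, hj q⟩
    induction q with
    | zero => simp [start_zero]
    | succ q ih =>
      have := hj 1 (2 * t * q)
      rw [mul_one] at this
      rw [mul_add, mul_one, this, ih, start_two_mul, mul_add, mul_one]
  rw [hq.2, hq.1]

theorem exists_lt_start (i : ℕ) : ∃ j, i < U.start (j + 1) :=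
  ⟨i, U.start_strictMono.le_apply⟩

open Classical in
/-- The index of the run at time `i`. -/
noncomputable def index (i : ℕ) : ℕ := Nat.find (U.exists_lt_start i)

/-- The landing word with the given runs. -/
noncomputable def word (i : ℕ) : Option (Fin 2) :=
  if U.start (U.index i + 1) - i ∈ U.sets (U.index i) then some (alternatingColor (U.index i))
  else none

theorem index_eq {u x j : ℕ} (hx : 1 ≤ x) (hx' : x ≤ (U.sets j).sup id)
    (hu : u + x = U.start (j + 1)) : U.index u = j := by
  classical
  rw [index, Nat.find_eq_iff]
  refine ⟨by omega, fun l hl => ?_⟩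
  have h1 := U.start_strictMono.monotone (show l + 1 ≤ j from hl)
  have h2 := U.start_succ j
  omega

theorem runs : Runs U.word (fun j => U.sets j) U.start alternatingColor where
  nonempty j := U.nonempty j
  pos j := U.pos j
  start_succ := U.start_succ
  color_succ := alternatingColor_succ_ne
  hit j x u hx hx' hu := by
    rw [word, U.index_eq hx hx' hu, show U.start (j + 1) - u = x by omega]

theorem word_add_self (i : ℕ) : U.word (i + n) = U.word i := by
  obtain ⟨j, x, hx, hx', hu⟩ := U.runs.exists_block (u := i) (Nat.zero_le i)
  have h1 := U.start_add (j + 1) 1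
  rw [mul_one, mul_one, add_right_comm] at h1
  have hc : ((j + 2 * t : ℕ) : ZMod (2 * t)) = j := by
    rw [Nat.cast_add, ZMod.natCast_self, add_zero]
  rw [U.runs.hit j x i hx hx' hu,
    U.runs.hit (j + 2 * t) x (i + n) hx (by simpa only [hc] using hx') (by omega)]
  simp only [hc]
  rw [alternatingColor_eq_iff.2 (show (j + 2 * t) % 2 = j % 2 by omega)]

theorem isPrimeWord : IsPrimeWord n U.word where
  periodic := U.word_add_self
  exists_hit i a := by
    obtain ⟨j, x, hx, hx', hu⟩ := U.runs.exists_block (u := i) (Nat.zero_le i)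
    have h1 := alternatingColor_succ_ne (j + 1)
    have h2 := U.start_strictMono (Nat.lt_add_one (j + 1))
    have h3 : alternatingColor (j + 1) = a ∨ alternatingColor (j + 1 + 1) = a := by omega
    rcases h3 with rfl | rfl
    · exact ⟨x, by rw [hu, U.runs.hit_start]⟩
    · refine ⟨U.start (j + 1 + 1) - i, ?_⟩
      rw [show i + (U.start (j + 1 + 1) - i) = U.start (j + 1 + 1) by omega]
      exact U.runs.hit_start _
  prime := by
    -- Equal colors make `j' - j` even. A common distance then forces `2 * t` to divide it, so the
    -- two landings differ by whole periods.
    have aux : ∀ j j' x u u', j ≤ j' → alternatingColor j = alternatingColor j' →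
        x ∈ U.sets j → x ∈ U.sets j' → u + x = U.start (j + 1) → u' + x = U.start (j' + 1) →
        u ≡ u' [MOD n] := by
      intro j j' x u u' hjj hc hx hx' hu hu'
      rw [alternatingColor_eq_iff] at hc
      obtain ⟨i, rfl⟩ : ∃ i, j' = j + 2 * i := ⟨(j' - j) / 2, by omega⟩
      have h2 : (2 * i : ZMod (2 * t)) = 0 := by
        by_contra hne
        have := U.disjoint i j hne
        rw [Nat.cast_add, Nat.cast_mul, Nat.cast_ofNat] at hx'
        exact Finset.disjoint_left.1 this hx hx'
      have h3 : ((2 * i : ℕ) : ZMod (2 * t)) = 0 := by rw [← h2]; push_cast; rfl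
      obtain ⟨q, hq⟩ := (ZMod.natCast_eq_zero_iff _ _).1 h3
      have h4 := U.start_add (j + 1) q
      rw [← hq, add_right_comm] at h4
      have h5 : u' = u + n * q := by omega
      rw [h5]
      simp [Nat.ModEq]
    intro u u' a b k hab hu hu' hk hk'
    have key : ∀ u, U.word u = some a → FirstHit U.word u b k → ∃ j, u + k = U.start (j + 1) ∧
        k ∈ U.sets j ∧ alternatingColor j = a := by
      intro u hu hk
      obtain ⟨j, x, hx, hx', hux⟩ := U.runs.exists_block (u := u) (Nat.zero_le u)
      obtain ⟨hmem, hc⟩ := U.runs.mem_of_hit hx hx' hux hu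
      have h1 := U.runs.firstHit hmem hux
      have h2 := alternatingColor_succ_ne j
      rw [show alternatingColor (j + 1) = b by omega] at h1
      rw [hk.unique h1]
      exact ⟨j, hux, hmem, hc⟩
    obtain ⟨j, h1, h2, h3⟩ := key u hu hk
    obtain ⟨j', h1', h2', h3'⟩ := key u' hu' hk'
    rcases le_total j j' with hle | hle
    · exact aux j j' k u u' hle (h3.trans h3'.symm) h2 h2' h1 h1'
    · exact (aux j' j k u' u hle (h3'.trans h3.symm) h2' h2 h1' h1).symm

theorem word_vadd (k : ℕ) : ∃ π : Equiv.Perm (Fin 2),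
    ∀ i, ((k : ZMod (2 * t)) +ᵥ U).word i = (U.word (i + U.start k)).map π := by
  have hs : ∀ j, U.start (j + k) = ((k : ZMod (2 * t)) +ᵥ U).start j + U.start k := by
    intro j
    induction j with
    | zero => simp [start_zero]
    | succ j ih =>
      rw [add_right_comm, start_succ, ih, start_succ, vadd_sets, Nat.cast_add]
      omega
  have H : Runs U.word (fun j => U.sets (j + k : ℕ)) (fun j => U.start (j + k))
      (fun j => alternatingColor (j + k)) :=
    { nonempty := fun j => U.nonempty _
      pos := fun j => U.pos _
      start_succ := fun j => by rw [add_right_comm, start_succ]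
      color_succ := fun j => by
        rw [add_right_comm]
        exact alternatingColor_succ_ne _
      hit := fun j x u hx hx' hu =>
        U.runs.hit (j + k) x u hx hx' (by rw [hu, add_right_comm]) }
  -- Each constructed word starts with color `0`, so a rotation by an odd number of runs must swap
  -- the colors.
  refine ⟨Equiv.addRight (alternatingColor k),
    H.map_hit ((k : ZMod (2 * t)) +ᵥ U).runs rfl hs ?_ ?_⟩
  · intro j
    simp only [vadd_sets, Nat.cast_add]
  · intro j
    simp only [Equiv.coe_addRight, alternatingColor, Fin.ext_iff, Fin.val_add, Fin.val_ofNat]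
    omega

theorem two_mul_le (U : RunSeq t n) : 2 * t ≤ n := by
  rw [← U.start_two_mul]
  exact U.start_strictMono.le_apply

/-- The prime walk with the given runs. -/
noncomputable def walk [NeZero n] : ColoredPrimeWalk n := U.isPrimeWord.walk

theorem hit_walk [NeZero n] : U.walk.hit = U.word := U.isPrimeWord.hit_walk

theorem walk_rel_walk_vadd [NeZero n] (k : ZMod (2 * t)) :
    (ColoredPrimeWalk.setoid n).r U.walk (k +ᵥ U).walk := by
  obtain ⟨k, rfl⟩ := ZMod.natCast_zmod_surjective k
  obtain ⟨π, hπ⟩ := U.word_vadd k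
  rw [ColoredPrimeWalk.rel_iff]
  simp only [hit_walk]
  exact ⟨_, π, hπ⟩

/-- Run boundaries are intrinsic to the word: once one boundary is matched, all later ones are, and
counting the runs in a period gives `t' = t`. -/
theorem eq_and_exists_vadd_of_rel [NeZero n] {t' : ℕ} [NeZero t'] (U' : RunSeq t' n)
    (h : (ColoredPrimeWalk.setoid n).r U.walk U'.walk) :
    t' = t ∧ ∃ m : ℕ, ∀ i : ℕ, U'.sets i = U.sets (m + i : ℕ) := by
  rw [ColoredPrimeWalk.rel_iff] at h
  simp only [hit_walk] at h
  obtain ⟨k, π, hπ⟩ := h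
  -- No run precedes time `0`, so nothing there certifies a color change. The boundary to match is
  -- instead the end of the last run `p` of the first period, at time `n`; hence the shift `k + n`
  -- below.
  obtain ⟨p, hp⟩ : ∃ p, 2 * t' = p + 1 :=
    ⟨2 * t' - 1, by have := NeZero.ne t'; omega⟩
  have h1 := U'.runs.firstHit (U'.runs.sup_mem p) (U'.start_succ p).symm
  have h2 := U'.runs.hit_start p
  obtain ⟨j, x, hx, hx', hu⟩ := U.runs.exists_block (u := U'.start p + k) (Nat.zero_le _)
  have h3 : U.word (U'.start p + k) = some (π.symm (alternatingColor p)) := by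
    rw [hπ] at h2
    obtain ⟨b, hb, hb'⟩ := Option.map_eq_some_iff.1 h2
    rw [hb, ← hb', Equiv.symm_apply_apply]
  obtain ⟨hmem, hc⟩ := U.runs.mem_of_hit hx hx' hu h3
  have h4 := U.runs.firstHit hmem hu
  have h5 : π (alternatingColor (j + 1)) = alternatingColor (p + 1) := by
    have h6 : π (alternatingColor j) = alternatingColor p := by rw [hc, Equiv.apply_symm_apply]
    have h7 := alternatingColor_succ_ne p
    have h8 : π (alternatingColor (j + 1)) ≠ π (alternatingColor j) :=
      fun h => alternatingColor_succ_ne j (π.injective h)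
    omega
  rw [← h5, FirstHit.map_iff hπ] at h1
  have h6 := h1.unique h4
  have h7 := U'.start_succ p
  have hn := U'.start_two_mul
  rw [hp] at hn
  have hper : ∀ i, U'.word i = (U.word (i + (k + n))).map π := by
    intro i
    rw [← add_assoc, U.word_add_self, hπ]
  have key := U.runs.unique U'.runs hper (m := j + 1) (by rw [start_zero]; omega)
  have h8 := (key (2 * t')).1
  have h9 := U.start_add (j + 1) 1
  have h10 := (key 0).1
  rw [start_two_mul] at h8
  rw [start_zero, add_zero] at h10
  have h11 := U.start_strictMono.injective
    (h8.trans (by omega : n + (k + n) = U.start (j + 1 + 2 * t * 1)))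
  exact ⟨by omega, j + 1, fun i => (key i).2.symm⟩

end RunSeq

/-! ### Cutting a prime walk into runs -/

namespace ColoredPrimeWalk

variable {n : ℕ}

/-- Jumping from a landing to the next landing of the other color produces the run starts. The
landing `u` certifies that `r 0` is a genuine color change and not the middle of a run. -/
theorem exists_runs (w : ColoredPrimeWalk n) : ∃ (V : ℕ → Finset ℕ) (r : ℕ → ℕ) (u : ℕ),
    Runs w.hit V r alternatingColor ∧ w.hit u = some 1 ∧ u ≤ r 0 ∧
      FirstHit w.hit u 0 (r 0 - u) := by
  have hd : ∀ i, ∃ d, ∀ a, w.hit i = some a → FirstHit w.hit i (a + 1) d := by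
    intro i
    rcases h : w.hit i with _ | a
    -- The value of `d` is irrelevant where no ball lands.
    · exact ⟨0, by simp⟩
    · obtain ⟨d, hd⟩ := w.exists_firstHit i (a + 1)
      refine ⟨d, fun b hb => ?_⟩
      rwa [← Option.some_injective _ hb]
  choose d hd using hd
  have hsucc : ∀ a : Fin 2, a + 1 ≠ a := by decide
  have hpos : ∀ i a, w.hit i = some a → 1 ≤ d i := by
    intro i a hi
    have h1 := hd i a hi
    by_contra hlt
    have h2 : d i = 0 := by omega
    rw [h2] at h1
    have h3 := h1.1
    rw [add_zero, hi] at h3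
    exact hsucc a (Option.some_injective _ h3).symm
  obtain ⟨u, hu⟩ := w.exists_firstHit 0 1
  have hu := hu.1
  rw [zero_add] at hu
  let r : ℕ → ℕ := fun j => (fun i => i + d i)^[j] (u + d u)
  have hr : ∀ j, r (j + 1) = r j + d (r j) := fun j => Function.iterate_succ_apply' _ _ _
  have hc : ∀ j, alternatingColor (j + 1) = alternatingColor j + 1 := by
    intro j
    simp only [alternatingColor, Fin.ext_iff, Fin.val_add, Fin.val_ofNat]
    omega
  have hh : ∀ j, w.hit (r j) = some (alternatingColor j) := by
    intro j
    induction j with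
    | zero => exact (hd u 1 hu).1
    | succ j ih => rw [hr, hc]; exact (hd _ _ ih).1
  let V : ℕ → Finset ℕ := fun j =>
    (Finset.Icc 1 (d (r j))).filter fun x => w.hit (r (j + 1) - x) ≠ none
  have hmem : ∀ j, d (r j) ∈ V j := by
    intro j
    simp only [V, Finset.mem_filter, Finset.mem_Icc, hr, Nat.add_sub_cancel, hh]
    exact ⟨⟨hpos _ _ (hh j), le_rfl⟩, by simp⟩
  have hsup : ∀ j, (V j).sup id = d (r j) := by
    intro j
    refine le_antisymm (Finset.sup_le fun x hx => ?_) (Finset.le_sup (f := id) (hmem j))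
    exact (Finset.mem_Icc.1 (Finset.mem_filter.1 hx).1).2
  refine ⟨V, r, u, ?_, hu, Nat.le_add_right _ _, ?_⟩
  · exact
    { nonempty := fun j => ⟨_, hmem j⟩
      pos := fun j x hx => (Finset.mem_Icc.1 (Finset.mem_filter.1 hx).1).1
      start_succ := fun j => by rw [hr, hsup]
      color_succ := alternatingColor_succ_ne
      hit := by
        intro j x v hx hx' hv
        rw [hsup] at hx'
        have hvx : r (j + 1) - x = v := by omega
        have hVx : x ∈ V j ↔ w.hit v ≠ none := by
          simp only [V, Finset.mem_filter, Finset.mem_Icc, hvx]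
          tauto
        rcases h : w.hit v with _ | a
        · simp [hVx, h]
        · rw [if_pos (hVx.2 (by simp [h]))]
          have h1 := (hd _ _ (hh j)).2 (d (r j) - x) (by omega)
          have h2 := hr j
          rw [show r j + (d (r j) - x) = v by omega, h] at h1
          have h3 : a ≠ alternatingColor j + 1 := fun h => h1 (congrArg some h)
          congr 1
          omega }
  · have h1 : r 0 - u = d u := Nat.add_sub_cancel_left _ _
    rw [h1]
    exact hd u 1 hu

theorem exists_start_eq_add [NeZero n] (w : ColoredPrimeWalk n) {V : ℕ → Finset ℕ} {r : ℕ → ℕ}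
    {u : ℕ} (H : Runs w.hit V r alternatingColor) (hu : w.hit u = some 1) (hu0 : u ≤ r 0)
    (hur : FirstHit w.hit u 0 (r 0 - u)) : ∃ t, 0 < t ∧ r (2 * t) = r 0 + n := by
  obtain ⟨j, x, hx, hx', hj⟩ := H.exists_block (u := r 0 + n) (by omega)
  have h0 : w.hit (r 0 + n) = some (alternatingColor 0) := by rw [w.hit_add_self, H.hit_start]
  obtain ⟨hmem, hc⟩ := H.mem_of_hit hx hx' hj h0
  rw [alternatingColor_eq_iff] at hc
  have hs := H.start_succ j
  have hle : r j ≤ r 0 + n := by omega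
  have heq : r j = r 0 + n := by
    -- Otherwise a run of color `0` begins before `r 0 + n` and contains it. Its start is not in `[u
    -- + n, r 0 + n)`, where color `0` does not land, so the run also contains the landing of color
    -- `1` at `u + n`.
    by_contra hne
    have hcj : alternatingColor j = 0 := (alternatingColor_eq_iff (j := 0)).2 hc
    have h1 : r j < u + n := by
      by_contra hge
      have h2 := hur.2 (r j - n - u) (by omega)
      rw [← w.hit_add_self, show u + (r j - n - u) + n = r j by omega, H.hit_start, hcj] at h2
      exact h2 rfl
    have h2 : w.hit (u + n) = some 1 := by rw [w.hit_add_self, hu]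
    have h3 := (H.mem_of_hit (x := r (j + 1) - (u + n)) (j := j) (by omega) (by omega)
      (by omega) h2).2
    rw [hcj] at h3
    exact absurd h3 (by decide)
  have hn := NeZero.pos n
  refine ⟨j / 2, ?_, ?_⟩
  · rcases Nat.eq_zero_or_pos j with rfl | hpos
    · omega
    · omega
  · rwa [show 2 * (j / 2) = j by omega]

theorem exists_runSeq [NeZero n] (w : ColoredPrimeWalk n) :
    ∃ (t : ℕ) (_ : t < n) (U : RunSeq (t + 1) n), (setoid n).r w U.walk := by
  obtain ⟨V, r, u, H, hu, hu0, hur⟩ := w.exists_runs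
  obtain ⟨t, ht, hrt⟩ := w.exists_start_eq_add H hu hu0 hur
  obtain ⟨t, rfl⟩ : ∃ s, t = s + 1 := ⟨t - 1, by omega⟩
  have hper : ∀ i, r (2 * (t + 1) + i) = r i + n ∧ V (2 * (t + 1) + i) = V i :=
    H.unique H (π := 1) (fun i => by simp [w.hit_add_self]) hrt
  have hmod : ∀ i, V (i % (2 * (t + 1))) = V i :=
    Function.Periodic.map_mod_nat (f := V) fun i => by rw [add_comm, (hper i).2]
  have hval : ∀ j : ℕ, V (j : ZMod (2 * (t + 1))).val = V j := fun j => by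
    rw [ZMod.val_natCast, hmod]
  have hsum : ∀ j, r j = ∑ i ∈ Finset.range j, (V i).sup id + r 0 := by
    intro j
    induction j with
    | zero => simp
    | succ j ih => rw [H.start_succ, ih, Finset.sum_range_succ]; omega
  let U : RunSeq (t + 1) n :=
    { sets := fun j => V j.val
      nonempty := fun j => H.nonempty _
      pos := fun j => H.pos _
      sum_max := by
        rw [← ZMod.sum_range_natCast fun j => (V j.val).sup id]
        simp only [hval]
        have := hsum (2 * (t + 1))
        omega
      -- A distance shared by two runs of one color yields two landings with equal states, hence
      -- times congruent modulo `n`. With the run indices reduced to a single period, the times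
      -- coincide, and so do the runs.
      disjoint := by
        intro i j hi
        obtain ⟨i, rfl⟩ := ZMod.natCast_zmod_surjective i
        obtain ⟨j, rfl⟩ := ZMod.natCast_zmod_surjective j
        rw [Finset.disjoint_left]
        intro x hx hx'
        rw [show (j : ZMod (2 * (t + 1))) + 2 * i = (j + 2 * i : ℕ) by push_cast; rfl] at hx'
        refine hi ?_
        rw [← add_eq_left (a := (j : ZMod (2 * (t + 1)))),
          show (j : ZMod (2 * (t + 1))) + 2 * i = (j + 2 * i : ℕ) by push_cast; rfl]
        rw [ZMod.val_natCast] at hx hx'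
        have hlt := Nat.mod_lt j (show 0 < 2 * (t + 1) by omega)
        have hlt' := Nat.mod_lt (j + 2 * i) (show 0 < 2 * (t + 1) by omega)
        have hcol : alternatingColor (j % (2 * (t + 1))) =
            alternatingColor ((j + 2 * i) % (2 * (t + 1))) := by
          rw [alternatingColor_eq_iff, Nat.mod_mul_right_mod, Nat.mod_mul_right_mod]
          omega
        rw [ZMod.natCast_eq_natCast_iff']
        generalize j % (2 * (t + 1)) = k at *
        generalize (j + 2 * i) % (2 * (t + 1)) = k' at *
        have hs := H.start_succ k
        have hs' := H.start_succ k'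
        have hle := H.le_sup hx
        have hle' := H.le_sup hx'
        have h1 := H.pos k x hx
        have hux : r (k + 1) - x + x = r (k + 1) := by omega
        have hux' : r (k' + 1) - x + x = r (k' + 1) := by omega
        have h2 := H.hit_of_mem hx hux
        have h2' := H.hit_of_mem hx' hux'
        have h3 := H.firstHit hx hux
        have h3' := H.firstHit hx' hux'
        have h4 : alternatingColor (k' + 1) = alternatingColor (k + 1) := by
          rw [alternatingColor_eq_iff] at hcol ⊢
          omega
        rw [← hcol] at h2'
        rw [h4] at h3'
        have h5 := w.eq_of_firstHit (alternatingColor_succ_ne k).symm h2 h2' h3 h3'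
        have h6 := H.strictMono.monotone (show k + 1 ≤ 2 * (t + 1) from hlt)
        have h6' := H.strictMono.monotone (show k' + 1 ≤ 2 * (t + 1) from hlt')
        have h7 := H.strictMono.monotone (Nat.zero_le k)
        have h7' := H.strictMono.monotone (Nat.zero_le k')
        have h8 : (r (k' + 1) - x - r 0) = (r (k + 1) - x - r 0) := by
          refine Nat.ModEq.eq_of_lt_of_lt (m := n) (Nat.ModEq.add_right_cancel' (r 0) ?_)
            (by omega) (by omega)
          rw [show r (k' + 1) - x - r 0 + r 0 = r (k' + 1) - x by omega,
            show r (k + 1) - x - r 0 + r 0 = r (k + 1) - x by omega]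
          exact h5.symm
        have h9 := H.strictMono.injective (show r (k' + 1) = r (k + 1) by omega)
        omega }
  have hle := U.two_mul_le
  refine ⟨t, by omega, U, rel_iff.2 ⟨r 0, 1, ?_⟩⟩
  rw [U.hit_walk]
  refine H.map_hit U.runs rfl (fun j => ?_) (fun j => (hval j).symm) fun j => rfl
  rw [hsum, RunSeq.start]
  simp only [U, hval]

end ColoredPrimeWalk

/-! ### Patterns as orbits of run sequences -/

namespace RunSeq

variable {t n : ℕ} [NeZero t] [NeZero n]

/-- The pattern of the prime walk with the given cyclic sequence of runs. -/
noncomputable def pattern (q : AddAction.orbitRel.Quotient (ZMod (2 * t)) (RunSeq t n)) :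
    ColoredPrimePattern n :=
  Quotient.lift (fun U : RunSeq t n => (Quotient.mk _ U.walk : ColoredPrimePattern n))
    (fun U U' h => by
      obtain ⟨k, rfl⟩ := AddAction.orbitRel_apply.1 h
      exact Quotient.sound ((ColoredPrimeWalk.setoid n).symm (U'.walk_rel_walk_vadd k))) q

end RunSeq

/-- The index `t : Fin n` stands for `t + 1` pairs of runs; the range suffices because every run has
length at least one. -/
theorem ColoredPrimePattern.bijective_pattern (n : ℕ) [NeZero n] :
    Function.Bijective (fun q : Σ t : Fin n, AddAction.orbitRel.Quotient
      (ZMod (2 * (t.val + 1))) (RunSeq (t.val + 1) n) => RunSeq.pattern q.2) := by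
  constructor
  · rintro ⟨⟨t, ht⟩, q⟩ ⟨⟨t', ht'⟩, q'⟩ h
    induction q using Quotient.inductionOn with | _ U
    induction q' using Quotient.inductionOn with | _ U'
    obtain ⟨htt, m, hm⟩ := U.eq_and_exists_vadd_of_rel U' (Quotient.exact h)
    obtain rfl : t' = t := Nat.succ_injective htt
    congr 1
    refine Quotient.sound ((AddAction.orbitRel _ _).symm ?_)
    refine AddAction.orbitRel_apply.2 ⟨m, RunSeq.ext (funext fun i => ?_)⟩
    obtain ⟨i, rfl⟩ := ZMod.natCast_zmod_surjective i
    change U.sets (i + m) = U'.sets i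
    exact (congrArg U.sets ((add_comm _ _).trans (Nat.cast_add m i).symm)).trans (hm i).symm
  · intro p
    induction p using Quotient.inductionOn with | _ w
    obtain ⟨t, ht, U, hU⟩ := w.exists_runSeq
    exact ⟨⟨⟨t, ht⟩, Quotient.mk _ U⟩, Quotient.sound ((ColoredPrimeWalk.setoid n).symm hU)⟩

/-! ### Burnside's lemma and rotations of set sequences -/

theorem AddAction.sum_natCard_fixedBy (G X : Type*) [AddGroup G] [Fintype G] [AddAction G X]
    [Finite X] : ∑ g : G, Nat.card (AddAction.fixedBy X g) =
      Nat.card (AddAction.orbitRel.Quotient G X) * Fintype.card G := by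
  rw [← Nat.card_sigma, Nat.card_congr (AddAction.sigmaFixedByEquivOrbitsProdAddGroup G X),
    Nat.card_prod, Nat.card_eq_fintype_card (α := G)]

theorem Finset.sum_range_two_mul (f : ℕ → ℕ) (t : ℕ) :
    ∑ i ∈ Finset.range (2 * t), f i = ∑ i : Fin t, f (2 * i) + ∑ i : Fin t, f (2 * i + 1) := by
  rw [← Finset.sum_range fun i => f (2 * i), ← Finset.sum_range fun i => f (2 * i + 1)]
  induction t with
  | zero => simp
  | succ t ih =>
    rw [mul_add, mul_one, Finset.sum_range_succ, Finset.sum_range_succ, ih,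
      Finset.sum_range_succ, Finset.sum_range_succ]
    omega

namespace SpacingSeq

theorem ext_sets {t n : ℕ} {S T : SpacingSeq t n} (h : S.sets = T.sets) : S = T := by
  cases S
  cases T
  cases h
  rfl

theorem eq_of_sets_eq {t n : ℕ} (S : SpacingSeq t n) {i j : Fin t} (h : S.sets i = S.sets j) :
    i = j := by
  by_contra hne
  have h1 := S.disjoint i j hne
  rw [h, disjoint_self] at h1
  exact (S.nonempty j).ne_empty h1

variable {t n : ℕ}

/-- The cyclic rotation of a sequence by `k` places. -/
def rotate (S : SpacingSeq (t + 1) n) (k : Fin (t + 1)) : SpacingSeq (t + 1) n where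
  sets i := S.sets (i + k)
  nonempty _ := S.nonempty _
  pos _ := S.pos _
  disjoint _ _ hij := S.disjoint _ _ fun h => hij (add_right_cancel h)
  sum_max := (Equiv.sum_comp (Equiv.addRight k) fun i => (S.sets i).sup id).trans S.sum_max

theorem finRotate_zpow (k : ℤ) (i : Fin (t + 1)) :
    (finRotate (t + 1) ^ k) i = i + k • (1 : Fin (t + 1)) := by
  induction k generalizing i with
  | zero => simp
  | succ k ih => rw [zpow_add_one, Equiv.Perm.mul_apply, ih, finRotate_apply, add_zsmul,
      one_zsmul, add_assoc, add_comm 1]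
  | pred k ih =>
    have h : (finRotate (t + 1))⁻¹ i = i - 1 := by
      rw [Equiv.Perm.inv_eq_iff_eq, finRotate_apply, sub_add_cancel]
    rw [zpow_sub_one, Equiv.Perm.mul_apply, ih, h, sub_zsmul, one_zsmul, sub_add_eq_add_sub,
      add_sub_assoc, sub_eq_add_neg]

theorem rel_rotate (S : SpacingSeq (t + 1) n) (k : Fin (t + 1)) :
    (setoid (t + 1) n).r S (S.rotate k) := by
  refine ⟨k.val, fun i => ?_⟩
  rw [finRotate_zpow]
  have : ((k.val : ℤ) • (1 : Fin (t + 1))) = k := by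
    rw [natCast_zsmul]
    exact (nsmul_one (A := ZMod (t + 1)) k.val).trans (ZMod.natCast_zmod_val (n := t + 1) k)
  rw [this]
  rfl

theorem exists_eq_rotate {S T : SpacingSeq (t + 1) n} (h : (setoid (t + 1) n).r S T) :
    ∃ k, T = S.rotate k := by
  obtain ⟨k, hk⟩ := h
  refine ⟨k • 1, ext_sets (funext fun i => ?_)⟩
  rw [hk, finRotate_zpow]
  rfl

/-- Disjoint nonempty sets are distinct, so rotation acts freely and each cycle has exactly `t + 1`
representatives. -/
theorem natCard (t n : ℕ) : Nat.card (SpacingSeq (t + 1) n) =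
    (t + 1) * spacingCount (t + 1) n := by
  have h : Function.Bijective fun p : Fin (t + 1) × SpacingCycle (t + 1) n =>
      (Quotient.out p.2).rotate p.1 := by
    constructor
    · rintro ⟨i, q⟩ ⟨j, q'⟩ h
      have h' : (Quotient.out q).rotate i = (Quotient.out q').rotate j := h
      have hq : q = q' := by
        rw [← Quotient.out_eq q, ← Quotient.out_eq q']
        refine Quotient.sound ((setoid (t + 1) n).trans (rel_rotate _ i) ?_)
        rw [h']
        exact (setoid (t + 1) n).symm (rel_rotate _ j)
      subst hq
      have h0 := congrFun (congrArg sets h') 0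
      have h1 := (Quotient.out q).eq_of_sets_eq h0
      rw [zero_add, zero_add] at h1
      rw [h1]
    · intro S
      obtain ⟨k, hk⟩ := exists_eq_rotate (Quotient.mk_out (s := setoid (t + 1) n) S)
      exact ⟨(k, Quotient.mk _ S), hk.symm⟩
  rw [← Nat.card_congr (Equiv.ofBijective _ h), Nat.card_prod, Nat.card_fin, spacingCount]

end SpacingSeq

/-! ### Counting run sequences by color -/

namespace RunSeq

variable {t n : ℕ} [NeZero t]

theorem sum_max_range (f : ℕ → Finset ℕ) :
    ∑ i : ZMod (2 * t), (f i.val).sup id =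
      ∑ i : Fin t, (f (2 * i)).sup id + ∑ i : Fin t, (f (2 * i + 1)).sup id := by
  rw [← ZMod.sum_range_natCast, ← Finset.sum_range_two_mul fun i => (f i).sup id]
  refine Finset.sum_congr rfl fun i hi => ?_
  rw [ZMod.val_natCast, Nat.mod_eq_of_lt (Finset.mem_range.1 hi)]

theorem half_val_lt (j : ZMod (2 * t)) : j.val / 2 < t := by
  have := ZMod.val_lt j
  omega

theorem val_ne_of_two_mul_ne_zero {i j : ZMod (2 * t)} (hi : 2 * i ≠ 0) :
    (j + 2 * i).val % 2 = j.val % 2 ∧ (j + 2 * i).val ≠ j.val := by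
  constructor
  · obtain ⟨i, rfl⟩ := ZMod.natCast_zmod_surjective i
    obtain ⟨j, rfl⟩ := ZMod.natCast_zmod_surjective j
    rw [show (j : ZMod (2 * t)) + 2 * i = (j + 2 * i : ℕ) by push_cast; rfl,
      ZMod.val_natCast, ZMod.val_natCast, Nat.mod_mul_right_mod, Nat.mod_mul_right_mod]
    omega
  · intro h
    exact hi (add_eq_left.1 (ZMod.val_injective _ h))

/-- Interleaving of two sequences of sets. -/
def interleave {m : Fin (n + 1)} (S : SpacingSeq t m) (T : SpacingSeq t (n - m)) :
    RunSeq t n where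
  sets j := if j.val % 2 = 0 then S.sets ⟨j.val / 2, half_val_lt j⟩
    else T.sets ⟨j.val / 2, half_val_lt j⟩
  nonempty j := by
    split_ifs
    exacts [S.nonempty _, T.nonempty _]
  pos j := by
    split_ifs
    exacts [S.pos _, T.pos _]
  disjoint i j hi := by
    obtain ⟨h1, h2⟩ := val_ne_of_two_mul_ne_zero (j := j) hi
    rw [h1]
    split_ifs
    · exact S.disjoint _ _ (by rw [ne_eq, Fin.mk.injEq]; omega)
    · exact T.disjoint _ _ (by rw [ne_eq, Fin.mk.injEq]; omega)
  sum_max := by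
    let f : ℕ → Finset ℕ := fun j => if h : j / 2 < t then
      (if j % 2 = 0 then S.sets ⟨j / 2, h⟩ else T.sets ⟨j / 2, h⟩) else ∅
    have hf : ∀ j : ZMod (2 * t), (if j.val % 2 = 0 then S.sets ⟨j.val / 2, half_val_lt j⟩
        else T.sets ⟨j.val / 2, half_val_lt j⟩) = f j.val := fun j => by
      simp only [f, half_val_lt, dif_pos]
    simp only [hf]
    rw [sum_max_range]
    have h0 : ∀ i : Fin t, f (2 * i) = S.sets i := fun i => by simp [f]
    have h1 : ∀ i : Fin t, f (2 * i + 1) = T.sets i := fun i => by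
      have : (2 * i.val + 1) / 2 = i := by omega
      simp [f, this]
    simp only [h0, h1, S.sum_max, T.sum_max]
    have := m.is_lt
    omega

theorem interleave_sets_even {m : Fin (n + 1)} (S : SpacingSeq t m) (T : SpacingSeq t (n - m))
    (i : Fin t) : (interleave S T).sets (2 * i.val : ℕ) = S.sets i := by
  have h : ((2 * i.val : ℕ) : ZMod (2 * t)).val = 2 * i :=
    ZMod.val_natCast_of_lt (by omega)
  simp only [interleave, h]
  simp

theorem interleave_sets_odd {m : Fin (n + 1)} (S : SpacingSeq t m) (T : SpacingSeq t (n - m))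
    (i : Fin t) : (interleave S T).sets (2 * i.val + 1 : ℕ) = T.sets i := by
  have h : ((2 * i.val + 1 : ℕ) : ZMod (2 * t)).val = 2 * i + 1 :=
    ZMod.val_natCast_of_lt (by omega)
  have h' : (2 * i.val + 1) / 2 = i := by omega
  simp only [interleave, h, h']
  simp [Nat.add_mod]

theorem disjoint_of_mod_two_eq (U : RunSeq t n) {i j : ℕ} (hi : i < 2 * t) (hj : j < 2 * t)
    (hij : i % 2 = j % 2) (hne : i ≠ j) : Disjoint (U.sets i) (U.sets j) := by
  wlog hle : i ≤ j generalizing i j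
  · exact (this hj hi hij.symm hne.symm (by omega)).symm
  obtain ⟨k, rfl⟩ : ∃ k, j = i + 2 * k := ⟨(j - i) / 2, by omega⟩
  have h := U.disjoint k i (fun h => by
    have h1 : ((2 * k : ℕ) : ZMod (2 * t)) = 0 := by rw [← h]; push_cast; rfl
    rw [ZMod.natCast_eq_zero_iff] at h1
    have := Nat.le_of_dvd (by omega) h1
    omega)
  rwa [show (i : ZMod (2 * t)) + 2 * k = (i + 2 * k : ℕ) by push_cast; rfl] at h

/-- Even and odd places carry the two colors, and disjointness only relates places of equal parity.
The parameter `m` is the total length of the runs at even places. -/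
theorem bijective_interleave : Function.Bijective
    fun p : Σ m : Fin (n + 1), SpacingSeq t m × SpacingSeq t (n - m) =>
      interleave p.2.1 p.2.2 := by
  constructor
  · rintro ⟨m, S, T⟩ ⟨m', S', T'⟩ h
    have hs : interleave S T = interleave S' T' := h
    have hS : S.sets = S'.sets := by
      funext i
      rw [← interleave_sets_even S T, hs, interleave_sets_even]
    have hT : T.sets = T'.sets := by
      funext i
      rw [← interleave_sets_odd S T, hs, interleave_sets_odd]
    obtain rfl : m = m' := by
      refine Fin.ext ?_
      rw [← S.sum_max, hS, S'.sum_max]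
    rw [SpacingSeq.ext_sets hS, SpacingSeq.ext_sets hT]
  · intro U
    have hsum := sum_max_range (t := t) fun j => U.sets j
    simp only [ZMod.natCast_zmod_val] at hsum
    rw [U.sum_max] at hsum
    let m : Fin (n + 1) := ⟨∑ i : Fin t, (U.sets (2 * i.val : ℕ)).sup id, by omega⟩
    let S : SpacingSeq t m :=
      { sets := fun i => U.sets (2 * i.val : ℕ)
        nonempty := fun i => U.nonempty _
        pos := fun i => U.pos _
        disjoint := fun i j hij => U.disjoint_of_mod_two_eq (by omega) (by omega) (by omega)
          (by omega)
        sum_max := rfl }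
    let T : SpacingSeq t (n - m) :=
      { sets := fun i => U.sets (2 * i.val + 1 : ℕ)
        nonempty := fun i => U.nonempty _
        pos := fun i => U.pos _
        disjoint := fun i j hij => U.disjoint_of_mod_two_eq (by omega) (by omega) (by omega)
          (by omega)
        sum_max := by simp only [m]; omega }
    refine ⟨⟨m, S, T⟩, RunSeq.ext (funext fun j => ?_)⟩
    rw [← ZMod.natCast_zmod_val j]
    have hj := half_val_lt j
    rcases Nat.mod_two_eq_zero_or_one j.val with h | h
    · have h1 : j.val = 2 * (⟨j.val / 2, hj⟩ : Fin t).val := by simp only; omega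
      rw [h1]
      exact interleave_sets_even S T _
    · have h1 : j.val = 2 * (⟨j.val / 2, hj⟩ : Fin t).val + 1 := by simp only; omega
      rw [h1]
      exact interleave_sets_odd S T _

instance : Finite (RunSeq t n) :=
  Finite.of_surjective _ bijective_interleave.2

theorem natCard (t n : ℕ) : Nat.card (RunSeq (t + 1) n) = ∑ m ∈ Finset.range (n + 1),
    (t + 1) * spacingCount (t + 1) m * ((t + 1) * spacingCount (t + 1) (n - m)) := by
  rw [← Nat.card_congr (Equiv.ofBijective _ bijective_interleave), Nat.card_sigma,
    Finset.sum_range]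
  refine Finset.sum_congr rfl fun m _ => ?_
  rw [Nat.card_prod, SpacingSeq.natCard, SpacingSeq.natCard]

/-! ### Fixed points of rotations -/

/-- A nonzero even period would make a nonempty set disjoint from itself. -/
theorem two_mul_eq_zero_of_vadd_eq {U : RunSeq t n} {k i l : ZMod (2 * t)} (h : k +ᵥ U = U)
    (hl : l = k ∨ l = k + k) (hi : l = 2 * i) : 2 * i = 0 := by
  have h1 : l +ᵥ U = U := by
    rcases hl with rfl | rfl
    · exact h
    · rw [add_vadd, h, h]
  by_contra hne
  have h2 := U.disjoint i 0 hne
  have h3 : U.sets (0 + l) = U.sets 0 := congrFun (congrArg RunSeq.sets h1) 0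
  rw [← hi, h3, disjoint_self] at h2
  exact (U.nonempty 0).ne_empty h2

/-- Twice a period is an even period, hence zero, which leaves only `t`; for even `t`, this would
itself be a nonzero even period. -/
theorem eq_of_vadd_eq {U : RunSeq t n} {k : ZMod (2 * t)} (h : k +ᵥ U = U) (hk : k ≠ 0) :
    k = t ∧ Odd t := by
  have h1 := two_mul_eq_zero_of_vadd_eq h (Or.inr rfl) (two_mul k).symm
  have h2 : k = t := by
    obtain ⟨k, hlt, rfl⟩ : ∃ l : ℕ, l < 2 * t ∧ k = l :=
      ⟨k.val, ZMod.val_lt k, (ZMod.natCast_zmod_val k).symm⟩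
    have h3 : ((2 * k : ℕ) : ZMod (2 * t)) = 0 := by rw [← h1]; push_cast; rfl
    obtain ⟨q, hq⟩ := (ZMod.natCast_eq_zero_iff _ _).1 h3
    have h4 : k = t * q := by rw [mul_assoc] at hq; omega
    have h5 : q < 2 := by
      by_contra hge
      have := Nat.mul_le_mul_left t (show 2 ≤ q by omega)
      omega
    have h6 : q ≠ 0 := by
      rintro rfl
      simp [h4] at hk
    rw [h4, show q = 1 by omega, mul_one]
  refine ⟨h2, ?_⟩
  by_contra ho
  obtain ⟨s, hs⟩ := Nat.not_odd_iff_even.1 ho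
  have h4 : k = 2 * (s : ZMod (2 * t)) := by
    rw [h2, two_mul (s : ZMod (2 * t)), ← Nat.cast_add]
    exact congrArg Nat.cast hs
  have h3 := two_mul_eq_zero_of_vadd_eq h (Or.inl rfl) h4
  exact hk (h4.trans h3)

theorem sets_natCast_add {U : RunSeq t n} (h : (t : ZMod (2 * t)) +ᵥ U = U) (i : ℕ) :
    U.sets (i + t : ℕ) = U.sets i := by
  rw [Nat.cast_add]
  exact congrFun (congrArg RunSeq.sets h) i

theorem sum_max_range_of_periodic (f : ℕ → Finset ℕ) (hf : ∀ i, f (i + t) = f i) :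
    ∑ i : ZMod (2 * t), (f i.val).sup id = 2 * ∑ i : Fin t, (f i).sup id := by
  have h := ZMod.sum_range_natCast fun i : ZMod (2 * t) => (f i.val).sup id
  rw [← h, ← Finset.sum_range fun i => (f i).sup id]
  have h1 : ∀ i ∈ Finset.range (2 * t), (f (i : ZMod (2 * t)).val).sup id = (f i).sup id := by
    intro i hi
    rw [ZMod.val_natCast, Nat.mod_eq_of_lt (Finset.mem_range.1 hi)]
  rw [Finset.sum_congr rfl h1, two_mul, Finset.sum_range_add, two_mul]
  simp only [add_comm t, hf]

theorem sum_fin_of_vadd_eq {U : RunSeq t n} (h : (t : ZMod (2 * t)) +ᵥ U = U) :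
    n = 2 * ∑ i : Fin t, (U.sets (i.val : ℕ)).sup id := by
  rw [← sum_max_range_of_periodic (fun i => U.sets i) (sets_natCast_add h)]
  simp only [ZMod.natCast_zmod_val, U.sum_max]

/-- The sequence that runs twice through a sequence of odd length. -/
def double (ht : Odd t) {m : ℕ} (S : SpacingSeq t m) : RunSeq t (2 * m) where
  sets j := S.sets (Fin.ofNat t j.val)
  nonempty j := S.nonempty _
  pos j := S.pos _
  disjoint i j hi := by
    refine S.disjoint _ _ fun h => ?_
    obtain ⟨h1, h2⟩ := val_ne_of_two_mul_ne_zero (j := j) hi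
    rw [Fin.ext_iff, Fin.val_ofNat, Fin.val_ofNat] at h
    -- For odd `t`, residues modulo `2` and modulo `t` determine the residue modulo `2 * t`.
    have h3 : (j + 2 * i).val ≡ j.val [MOD 2 * t] :=
      (Nat.modEq_and_modEq_iff_modEq_mul
        (Nat.coprime_two_left.2 ht)).1 ⟨h1, h.symm⟩
    exact h2 (h3.eq_of_lt_of_lt (ZMod.val_lt _) (ZMod.val_lt _))
  sum_max := by
    rw [sum_max_range_of_periodic (fun i => S.sets (Fin.ofNat t i)) fun i => by
      congr 1
      rw [Fin.ext_iff, Fin.val_ofNat, Fin.val_ofNat, Nat.add_mod_right]]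
    have : ∀ i : Fin t, Fin.ofNat t i.val = i := fun i => by
      rw [Fin.ext_iff, Fin.val_ofNat, Nat.mod_eq_of_lt i.is_lt]
    simp only [this, S.sum_max]

theorem natCard_fixedBy_of_odd (ht : Odd t) (m : ℕ) :
    Nat.card (AddAction.fixedBy (RunSeq t (2 * m)) (t : ZMod (2 * t))) =
      Nat.card (SpacingSeq t m) := by
  symm
  have hlt : ∀ i : Fin t, ((i.val : ℕ) : ZMod (2 * t)).val = i := fun i =>
    ZMod.val_natCast_of_lt (by omega)
  have hof : ∀ i : Fin t, Fin.ofNat t i.val = i := fun i => by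
    rw [Fin.ext_iff, Fin.val_ofNat, Nat.mod_eq_of_lt i.is_lt]
  have hd : ∀ S : SpacingSeq t m, (t : ZMod (2 * t)) +ᵥ double ht S = double ht S := by
    intro S
    refine RunSeq.ext (funext fun j => ?_)
    change S.sets _ = S.sets _
    congr 1
    obtain ⟨j, rfl⟩ := ZMod.natCast_zmod_surjective j
    rw [← Nat.cast_add, ZMod.val_natCast, ZMod.val_natCast, Fin.ext_iff, Fin.val_ofNat,
      Fin.val_ofNat, Nat.mod_mul_left_mod, Nat.mod_mul_left_mod, Nat.add_mod_right]
  refine Nat.card_congr (Equiv.ofBijective (fun S => ⟨double ht S, hd S⟩) ⟨?_, ?_⟩)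
  · intro S S' h
    refine SpacingSeq.ext_sets (funext fun i => ?_)
    have h1 := congrFun (congrArg RunSeq.sets (congrArg Subtype.val h)) (i.val : ℕ)
    simpa only [double, hlt, hof] using h1
  · rintro ⟨U, hU⟩
    have hU : (t : ZMod (2 * t)) +ᵥ U = U := hU
    have hmod : ∀ i, U.sets (i % t : ℕ) = U.sets i :=
      Function.Periodic.map_mod_nat (f := fun i : ℕ => U.sets i) (sets_natCast_add hU)
    have hsum := sum_fin_of_vadd_eq hU
    let S : SpacingSeq t m :=
      { sets := fun i => U.sets (i.val : ℕ)
        nonempty := fun i => U.nonempty _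
        pos := fun i => U.pos _
        disjoint := by
          intro i j hij
          have hne : i.val ≠ j.val := fun h => hij (Fin.ext h)
          have hodd := Nat.odd_iff.1 ht
          by_cases h : i.val % 2 = j.val % 2
          · exact U.disjoint_of_mod_two_eq (by omega) (by omega) h hne
          -- Moving `j` by the odd period `t` flips its parity without changing the set, so
          -- disjointness extends across the two colors.
          · rw [← sets_natCast_add hU j.val]
            exact U.disjoint_of_mod_two_eq (by omega) (by omega) (by omega) (by omega)
        sum_max := by omega }
    refine ⟨S, Subtype.ext (RunSeq.ext (funext fun j => ?_))⟩
    change U.sets ((Fin.ofNat t j.val).val : ℕ) = U.sets j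
    rw [Fin.val_ofNat, hmod, ZMod.natCast_zmod_val]

theorem sum_natCard_fixedBy (t n : ℕ) :
    ∑ k : ZMod (2 * (t + 1)), Nat.card (AddAction.fixedBy (RunSeq (t + 1) n) k) =
      Nat.card (RunSeq (t + 1) n) +
        if Odd (t + 1) ∧ Even n then (t + 1) * spacingCount (t + 1) (n / 2) else 0 := by
  have ht : ((t + 1 : ℕ) : ZMod (2 * (t + 1))) ≠ 0 := by
    rw [ne_eq, ZMod.natCast_eq_zero_iff]
    intro h
    have := Nat.le_of_dvd (by omega) h
    omega
  rw [← Finset.add_sum_erase _ _ (Finset.mem_univ 0),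
    ← Finset.add_sum_erase _ _ (Finset.mem_erase.2 ⟨ht, Finset.mem_univ _⟩),
    Finset.sum_eq_zero, add_zero]
  · congr 1
    · refine Nat.card_congr ((Equiv.setCongr ?_).trans (Equiv.Set.univ _))
      exact Set.eq_univ_of_forall fun U => zero_vadd _ U
    · split_ifs with h
      · obtain ⟨m, rfl⟩ := even_iff_two_dvd.1 h.2
        rw [natCard_fixedBy_of_odd h.1, SpacingSeq.natCard, Nat.mul_div_cancel_left _ two_pos]
      · rw [Nat.card_eq_zero]
        left
        refine ⟨fun ⟨U, hU⟩ => h ⟨(eq_of_vadd_eq hU ht).2, ?_⟩⟩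
        exact even_iff_two_dvd.2 ⟨_, sum_fin_of_vadd_eq hU⟩
  · intro k hk
    rw [Finset.mem_erase, Finset.mem_erase] at hk
    rw [Nat.card_eq_zero]
    left
    exact ⟨fun ⟨U, hU⟩ => hk.1 (eq_of_vadd_eq hU hk.2.1).1⟩

end RunSeq

/-! ### Folding the sums and assembling the formulas -/

theorem Finset.sum_Icc_one_eq_sum_range (f : ℕ → ℕ) (q : ℕ) :
    ∑ m ∈ Finset.Icc 1 q, f m = ∑ m ∈ Finset.range q, f (m + 1) := by
  induction q with
  | zero => simp
  | succ q ih => rw [Finset.sum_Icc_succ_top (by omega), ih, Finset.sum_range_succ]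

theorem Finset.sum_range_symm_odd (f : ℕ → ℕ) (q : ℕ) (h0 : f 0 = 0)
    (hf : ∀ m ≤ 2 * q + 1, f (2 * q + 1 - m) = f m) :
    ∑ m ∈ Finset.range (2 * q + 1 + 1), f m = 2 * ∑ m ∈ Finset.Icc 1 q, f m := by
  have h1 : ∑ m ∈ Finset.range (q + 1), f (q + 1 + m) = ∑ m ∈ Finset.range (q + 1), f m := by
    rw [← Finset.sum_range_reflect]
    refine Finset.sum_congr rfl fun m hm => ?_
    rw [Finset.mem_range] at hm
    rw [← hf m (by omega)]
    congr 1
    omega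
  rw [show 2 * q + 1 + 1 = (q + 1) + (q + 1) by omega, Finset.sum_range_add, h1,
    Finset.sum_range_succ', h0, Finset.sum_Icc_one_eq_sum_range]
  omega

theorem Finset.sum_range_symm_even (f : ℕ → ℕ) (q : ℕ) (hq : 1 ≤ q) (h0 : f 0 = 0)
    (hf : ∀ m ≤ 2 * q, f (2 * q - m) = f m) :
    ∑ m ∈ Finset.range (2 * q + 1), f m = 2 * ∑ m ∈ Finset.Icc 1 (q - 1), f m + f q := by
  obtain ⟨p, rfl⟩ : ∃ p, q = p + 1 := ⟨q - 1, by omega⟩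
  have h1 : ∑ m ∈ Finset.range (p + 1), f (p + 1 + 1 + m) = ∑ m ∈ Finset.range (p + 1), f m := by
    rw [← Finset.sum_range_reflect]
    refine Finset.sum_congr rfl fun m hm => ?_
    rw [Finset.mem_range] at hm
    rw [← hf m (by omega)]
    congr 1
    omega
  rw [show 2 * (p + 1) + 1 = (p + 1 + 1) + (p + 1) by omega, Finset.sum_range_add, h1,
    Finset.sum_range_succ _ (p + 1), Finset.sum_range_succ', h0, Nat.add_sub_cancel,
    Finset.sum_Icc_one_eq_sum_range]
  omega

theorem Nat.ceil_cast_div_two (t : ℕ) : ⌈(t : ℚ) / 2⌉₊ = (t + 1) / 2 := by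
  rcases Nat.even_or_odd' t with ⟨s, rfl | rfl⟩
  · rw [show ((2 * s : ℕ) : ℚ) / 2 = (s : ℕ) by push_cast; ring, Nat.ceil_natCast]
    omega
  · rw [show (2 * s + 1 + 1) / 2 = s + 1 by omega, Nat.ceil_eq_iff (by omega)]
    push_cast
    constructor <;> linarith

theorem spacingCount_succ_zero (t : ℕ) : spacingCount (t + 1) 0 = 0 :=
  spacingCount_eq_zero_of_lt t.succ_pos

namespace RunSeq

theorem natCard_orbits_mul (t n : ℕ) :
    Nat.card (AddAction.orbitRel.Quotient (ZMod (2 * (t + 1))) (RunSeq (t + 1) n)) *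
      (2 * (t + 1)) = (t + 1) ^ 2 * ∑ m ∈ Finset.range (n + 1),
        spacingCount (t + 1) m * spacingCount (t + 1) (n - m) +
          if Odd (t + 1) ∧ Even n then (t + 1) * spacingCount (t + 1) (n / 2) else 0 := by
  have h := AddAction.sum_natCard_fixedBy (ZMod (2 * (t + 1))) (RunSeq (t + 1) n)
  rw [ZMod.card] at h
  rw [← h, sum_natCard_fixedBy, natCard, Finset.mul_sum]
  congr 1
  exact Finset.sum_congr rfl fun m _ => by ring

theorem natCard_orbits_of_odd (t q : ℕ) :
    Nat.card (AddAction.orbitRel.Quotient (ZMod (2 * (t + 1))) (RunSeq (t + 1) (2 * q + 1))) =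
      ∑ m ∈ Finset.Icc 1 q,
        (t + 1) * spacingCount (t + 1) m * spacingCount (t + 1) (2 * q + 1 - m) := by
  have h := natCard_orbits_mul t (2 * q + 1)
  rw [if_neg fun h => Nat.not_even_two_mul_add_one q h.2, Finset.sum_range_symm_odd _ q
    (by rw [spacingCount_succ_zero, zero_mul])
    (fun m hm => by rw [Nat.sub_sub_self hm, mul_comm])] at h
  simp only [mul_assoc, ← Finset.mul_sum]
  refine Nat.eq_of_mul_eq_mul_right (show 0 < 2 * (t + 1) by omega) ?_
  rw [h]
  ring

theorem natCard_orbits_of_even (t q : ℕ) (hq : 1 ≤ q) :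
    Nat.card (AddAction.orbitRel.Quotient (ZMod (2 * (t + 1))) (RunSeq (t + 1) (2 * q))) =
      (∑ m ∈ Finset.Icc 1 (q - 1),
        (t + 1) * spacingCount (t + 1) m * spacingCount (t + 1) (2 * q - m)) +
      ((t + 1) * (spacingCount (t + 1) q).choose 2 +
        ⌈((t + 1 : ℕ) : ℚ) / 2⌉₊ * spacingCount (t + 1) q) := by
  have h := natCard_orbits_mul t (2 * q)
  rw [Finset.sum_range_symm_even _ q hq (by rw [spacingCount_succ_zero, zero_mul])
    (fun m hm => by rw [Nat.sub_sub_self hm, mul_comm]), show 2 * q - q = q by omega,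
    Nat.mul_div_cancel_left q two_pos] at h
  simp only [mul_assoc, ← Finset.mul_sum]
  refine Nat.eq_of_mul_eq_mul_right (show 0 < 2 * (t + 1) by omega) ?_
  rw [h, Nat.ceil_cast_div_two]
  generalize ∑ m ∈ Finset.Icc 1 (q - 1),
    spacingCount (t + 1) m * spacingCount (t + 1) (2 * q - m) = A
  generalize spacingCount (t + 1) q = c
  have hc : 2 * c.choose 2 + c = c * c := by
    rw [Nat.choose_two_right, Nat.mul_div_cancel' (Nat.even_mul_pred_self c).two_dvd]
    rcases c with _ | c
    · rfl
    · rw [Nat.add_sub_cancel]; ring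
  -- The diagonal term contributes `t / 2` with `t + 1` in place of `t`; the extra fixed points,
  -- present only in the odd case, round this half up.
  have hceil : (if Odd (t + 1) ∧ Even (2 * q) then (t + 1) * c else 0) + (t + 1) * (t + 1) * c =
      2 * ((t + 1 + 1) / 2) * ((t + 1) * c) := by
    rcases Nat.even_or_odd (t + 1) with he | ho
    · rw [if_neg fun h => Nat.not_odd_iff_even.2 he h.1,
        show 2 * ((t + 1 + 1) / 2) = t + 1 by have := Nat.even_iff.1 he; omega]
      ring
    · rw [if_pos ⟨ho, even_two_mul q⟩,
        show 2 * ((t + 1 + 1) / 2) = t + 1 + 1 by have := Nat.odd_iff.1 ho; omega]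
      ring
  rw [mul_add, ← hc]
  linear_combination hceil

end RunSeq

theorem ColoredPrimePattern.natCard (n : ℕ) [NeZero n] : Nat.card (ColoredPrimePattern n) =
    ∑ t ∈ Finset.range n, Nat.card
      (AddAction.orbitRel.Quotient (ZMod (2 * (t + 1))) (RunSeq (t + 1) n)) := by
  rw [← Nat.card_congr (Equiv.ofBijective _ (bijective_pattern n)), Nat.card_sigma,
    Finset.sum_range]

theorem mainTheorem4 (n : ℕ) (hn : 1 ≤ n) :
    Finite (ColoredPrimePattern n) ∧
    (Odd n →
      Nat.card (ColoredPrimePattern n) =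
        ∑ m ∈ Finset.Icc 1 ((n - 1) / 2), ∑ t ∈ Finset.Icc 1 n,
          t * spacingCount t m * spacingCount t (n - m)) ∧
    (Even n →
      Nat.card (ColoredPrimePattern n) =
        (∑ m ∈ Finset.Icc 1 (n / 2 - 1), ∑ t ∈ Finset.Icc 1 n,
          t * spacingCount t m * spacingCount t (n - m)) +
        ∑ t ∈ Finset.Icc 1 n,
          (t * (spacingCount t (n / 2)).choose 2 +
            ⌈(t : ℚ) / 2⌉₊ * spacingCount t (n / 2))) := by
  have : NeZero n := ⟨by omega⟩
  refine ⟨Finite.of_surjective _ (ColoredPrimePattern.bijective_pattern n).2, ?_, ?_⟩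
  · rintro ⟨q, rfl⟩
    rw [Finset.sum_comm, Finset.sum_Icc_one_eq_sum_range, ColoredPrimePattern.natCard,
      Nat.add_sub_cancel, Nat.mul_div_cancel_left q two_pos]
    exact Finset.sum_congr rfl fun t _ => RunSeq.natCard_orbits_of_odd t q
  · intro he
    obtain ⟨q, rfl⟩ := even_iff_two_dvd.1 he
    rw [Finset.sum_comm, ← Finset.sum_add_distrib, Finset.sum_Icc_one_eq_sum_range,
      ColoredPrimePattern.natCard, Nat.mul_div_cancel_left q two_pos]
    exact Finset.sum_congr rfl fun t _ => RunSeq.natCard_orbits_of_even t q (by omega)
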